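/- Let $n\ge 0$ be an integer, $N=\{0,1\}^n$, let $S$ (seeds) and $M$ (outputs) be finite non-empty sets, and let $\mathrm{Ext}=\{f_s\}_{s\in S}$ be a family of functions $f_s:N\to M$. (Strong extractors are the case $M=S\times M'$, $f_s(x)=(s,f_s'(x))$.) Let $F_s$ be the $M\times N$ matrix with $(F_s)_{y,x}=1$ if $f_s(x)=y$ and $0$ otherwise, let $\upsilon_M$ be the uniform distribution on $M$, and put $$\Delta[\mathrm{Ext}](P)=\frac1{|S|}\sum_{s\in S}F_sP-\Big(\sum_{x\in N}P(x)\Big)\upsilon_M .$$ Let $k,\varepsilon\in\mathbb R$; logarithms are to base $2$. *Norms.* For $P$ in $\mathbb R^N$ or $\mathbb C^N$ let $\|P\|_{\cap\{2^k\ell_\infty,\ell_1\}}=\max\{2^k\|P\|_{\ell_\infty},\|P\|_{\ell_1}\}$, and let $\|\Delta[\mathrm{Ext}]:\cap\{2^k\ell_\infty,\ell_1\}\to\ell_1\|$ be the supremum of $\|\Delta[\mathrm{Ext}](P)\|_{\ell_1}$ over all $P$ with $\|P\|_{\cap\{2^k\ell_\infty,\ell_1\}}\le1$. For $Q\in\mathbb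 N$ regard $x\in \mathrm{Mat}_Q(\mathbb C^N)$ as a matrix on $\mathbb C^Q\otimes\mathbb C^N$ that is diagonal in the second factor, and put $$\|x\|_{M_Q(\cap\cdot\cap\{2^k\ell_\infty,\ell_1\})}=\inf_{x=ab^*}\max\{2^{k/2}\|a\|_\infty,\|\Gamma(a)\|_\infty\}\cdot\max\{2^{k/2}\|b\|_\infty,\|\Gamma(b)\|_\infty\},$$ where $a,b$ run over all matrices on $\mathbb C^Q\otimes\mathbb C^N$, $\|\cdot\|_\infty$ is the operator norm, and $\Gamma$ is linear with $\Gamma(|i\rangle\langle j|\otimes|k\rangle\langle l|)=|i\rangle\langle j|\otimes\langle k|\otimes\langle l|$. Similarly, for $z\in\mathrm{Mat}_Q(\mathbb C^M)$ let $\|z\|_{M_Q(\ell_1)}=\sup\|(A\otimes 1)z(B\otimes1)\|_1$, the supremum being over $A,B\in\mathrm{Mat}_Q$ with Hilbert–Schmidt norm at most $1$, and $\|\cdot\|_1$ the trace norm. Let $\|\Delta[\mathrm{Ext}]:\cap\cdot\cap\{2^k\ell_\infty,\ell_1\}\to\ell_1\|_{\mathrm{cb}}$ be the supremum over $Q\in\mathbb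 N$ of the norms of the entrywise maps $\mathrm{id}_{\mathrm{Mat}_Q}\otimes\Delta[\mathrm{Ext}]$ with respect to these norms. *Extractors.* $\mathrm{Ext}$ is a $(k,\varepsilon)$-extractor if $\|\frac1{|S|}\sum_sF_sP-\upsilon_M\|_{\ell_1}\le\varepsilon$ for every probability distribution $P$ on $N$ with $H_{\min}(P)=-\log\|P\|_{\ell_\infty}\ge k$. It is a quantum-proof $(k,\varepsilon)$-extractor if, for every $Q\in\mathbb N$ and every density matrix $\rho_{QN}=\sum_x\rho_x\otimes|x\rangle\langle x|$ with $\rho_x\in \mathrm{Mat}_Q$ positive semidefinite and $H_{\min}(N|Q)_\rho\ge k$, $$\Big\|\frac1{|S|}\sum_s(\mathrm{id}_Q\otimes F_s)(\rho_{QN})-\rho_Q\otimes\upsilon_M\Big\|_1\le\varepsilon ,$$ where $\rho_Q=\sum_x\rho_x$ and $H_{\min}(N|Q)_\rho=-\log\min\{t:\rho_{QN}\le t\,\sigma_Q\otimes 1_N\text{ for some density matrix }\sigma_Q\}$. Let $K_G$ be the (real) Grothendieck constant, i.e. the least $K$ such that, for every real matrix $(A_{ij})$, $\sum_{ij}A_{ij}\,\vec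 a_i\cdot\vec b_j\le K\max\{\sum_{ij}A_{ij}a_ib_j:a_i,b_j\in\mathbb{R},\ |a_i|,|b_j|\le1\}$ for all vectors $\vec a_i,\vec b_j$ of Euclidean norm at most $1$ in any $\mathbb R^d$. Then: 1. If $k\le n$ and $\|\Delta[\mathrm{Ext}]:\cap\{2^k\ell_\infty,\ell_1\}\to\ell_1\|\le\varepsilon$ (with real or with complex $P$), then $\|\Delta[\mathrm{Ext}]:\cap\cdot\cap\{2^k\ell_\infty,\ell_1\}\to\ell_1\|_{\mathrm{cb}}\le K_G\,2^{n-k}\varepsilon$. 2. If $\mathrm{Ext}$ is a $(k,\varepsilon)$-extractor, then it is a quantum-proof $(k+1,\,6K_G2^{n-k}\varepsilon)$-extractor. 3. In particular, if $n\ge1$, $k\ge n-\log n$ and $\mathrm{Ext}$ is a $(k,\varepsilon)$-extractor, then it is a quantum-proof $(k+1,\,6K_G\,n\,\varepsilon)$-extractor. -/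

import Mathlib

noncomputable section

namespace QExt

open scoped ENNReal Kronecker ComplexOrder MatrixOrder Matrix.Norms.L2Operator

/-! ### The Grothendieck constant -/

/-- `K` is an admissible constant in Grothendieck's inequality for real matrices: whenever the
bilinear form of `A` is bounded by `c` on scalars of modulus at most one, it is bounded by `K * c`
on vectors of Euclidean norm at most one (in any dimension). -/
def IsGrothendieckBound (K : ℝ) : Prop :=
  ∀ (p q : ℕ) (A : Matrix (Fin p) (Fin q) ℝ) (c : ℝ),
    (∀ (a : Fin p → ℝ) (b : Fin q → ℝ), (∀ i, |a i| ≤ 1) → (∀ j, |b j| ≤ 1) →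
      ∑ i, ∑ j, A i j * (a i * b j) ≤ c) →
    ∀ (d : ℕ) (a : Fin p → EuclideanSpace ℝ (Fin d)) (b : Fin q → EuclideanSpace ℝ (Fin d)),
      (∀ i, ‖a i‖ ≤ 1) → (∀ j, ‖b j‖ ≤ 1) →
      ∑ i, ∑ j, A i j * inner ℝ (a i) (b j) ≤ K * c

/-- The (real) Grothendieck constant: the least admissible constant. -/
def grothendieckConstant : ℝ := sInf {K : ℝ | IsGrothendieckBound K}

/-! ### Families of functions and the associated linear maps -/

section Classical

variable {X Y S : Type*} [Fintype X] [Fintype Y] [Fintype S] [DecidableEq Y]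

/-- The `0`-`1` matrix of a function `g : X → Y`; it sends the distribution of a random variable
`x` to the distribution of `g x`. -/
def funMatrix (𝕜 : Type*) [RCLike 𝕜] (g : X → Y) : Matrix Y X 𝕜 :=
  Matrix.of fun y x => if g x = y then 1 else 0

/-- The uniform distribution. -/
def uniform (𝕜 : Type*) [RCLike 𝕜] (Y : Type*) [Fintype Y] : Y → 𝕜 :=
  fun _ => (Fintype.card Y : 𝕜)⁻¹

/-- The linear map `P ↦ |S|⁻¹ ∑ₛ Fₛ P - (∑ₓ P x) • uniform`. -/
def extMap (𝕜 : Type*) [RCLike 𝕜] (f : S → X → Y) : (X → 𝕜) →ₗ[𝕜] (Y → 𝕜) :=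
  (Fintype.card S : 𝕜)⁻¹ • ∑ s, (funMatrix 𝕜 (f s)).mulVecLin
    - (LinearMap.toSpanSingleton 𝕜 (Y → 𝕜) (uniform 𝕜 Y)).comp (∑ x, LinearMap.proj x)

/-- The min-entropy (in bits) of a distribution; `‖P‖` is the sup norm. -/
def minEntropy (P : X → ℝ) : ℝ := -Real.logb 2 ‖P‖

/-- `f = (fₛ)ₛ` is a `(k, ε)`-extractor. -/
def IsExtractor (f : S → X → Y) (k ε : ℝ) : Prop :=
  ∀ P ∈ stdSimplex ℝ X, k ≤ minEntropy P →
    ∑ y, |((Fintype.card S : ℝ)⁻¹ • ∑ s, (funMatrix ℝ (f s)).mulVec P) y - uniform ℝ Y y| ≤ ε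

end Classical

/-! ### Bounded and completely bounded norms -/

/-- The norm `sup {β (u x) : α x ≤ 1}` of a map `u` with respect to norms `α` and `β`. -/
def boundedNorm {E F : Type*} (α : E → ℝ≥0∞) (β : F → ℝ≥0∞) (u : E → F) : ℝ≥0∞ :=
  ⨆ (x : E) (_ : α x ≤ 1), β (u x)

/-- The completely bounded norm of a linear map `u`, with respect to sequences of norms on the
matrix spaces `Mat_Q(E)` and `Mat_Q(F)`: the supremum over `Q` of the norms of the entrywise
amplifications of `u`. -/
def cbNorm {E F : Type*} [AddCommGroup E] [Module ℂ E] [AddCommGroup F] [Module ℂ F]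
    (α : ∀ Q : ℕ, Matrix (Fin Q) (Fin Q) E → ℝ≥0∞)
    (β : ∀ Q : ℕ, Matrix (Fin Q) (Fin Q) F → ℝ≥0∞) (u : E →ₗ[ℂ] F) : ℝ≥0∞ :=
  ⨆ Q : ℕ, boundedNorm (α Q) (β Q) fun x => x.map u

/-- The `ℓ₁` norm. -/
def l1Norm {𝕜 : Type*} [RCLike 𝕜] {Y : Type*} [Fintype Y] (v : Y → 𝕜) : ℝ≥0∞ :=
  ENNReal.ofReal (∑ y, ‖v y‖)

/-- The norm `∩{K ℓ_∞, ℓ₁}`. -/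
def capNorm {𝕜 : Type*} [RCLike 𝕜] {X : Type*} [Fintype X] (K : ℝ) (P : X → 𝕜) : ℝ≥0∞ :=
  ENNReal.ofReal (max (K * ‖P‖) (∑ x, ‖P x‖))

/-! ### Matrix norms; `‖·‖` on matrices is the operator norm -/

section Quantum

variable {ι q : Type*} [Fintype ι] [DecidableEq ι] [Fintype q] [DecidableEq q]

/-- The trace norm `Tr √(A* A)`. -/
def traceNorm (A : Matrix ι ι ℂ) : ℝ :=
  (CFC.sqrt (A.conjTranspose * A)).trace.re

/-- The Hilbert-Schmidt norm `√Tr(A* A)`. -/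
def hsNorm (A : Matrix ι ι ℂ) : ℝ :=
  √(A.conjTranspose * A).trace.re

/-- The map `|i⟩⟨j| ⊗ |k⟩⟨l| ↦ |i⟩⟨j| ⊗ ⟨k| ⊗ ⟨l|`. -/
def gammaMap (a : Matrix (q × ι) (q × ι) ℂ) : Matrix q (q × ι × ι) ℂ :=
  Matrix.of fun i jkl => a (i, jkl.2.1) (jkl.1, jkl.2.2)

/-- The norm `∩·∩{K M_N, S¹_N}` on `Mat_Q(Mat_N)`. -/
def capCapMatrixNorm (K : ℝ) (x : Matrix (q × ι) (q × ι) ℂ) : ℝ≥0∞ :=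
  ⨅ (a : Matrix (q × ι) (q × ι) ℂ) (b : Matrix (q × ι) (q × ι) ℂ)
    (_ : x = a * b.conjTranspose),
    ENNReal.ofReal (max (√K * ‖a‖) ‖gammaMap a‖ * max (√K * ‖b‖) ‖gammaMap b‖)

/-- The norm `(∞;1)` on `Mat_Q(Mat_N)`, i.e. the norm of `Mat_Q(S¹_N)`. -/
def inftyOneNorm (x : Matrix (q × ι) (q × ι) ℂ) : ℝ≥0∞ :=
  ⨆ (A : Matrix q q ℂ) (B : Matrix q q ℂ) (_ : hsNorm A ≤ 1) (_ : hsNorm B ≤ 1),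
    ENNReal.ofReal (traceNorm ((A ⊗ₖ (1 : Matrix ι ι ℂ)) * x * (B ⊗ₖ (1 : Matrix ι ι ℂ))))

/-- The embedding of `Mat_Q(ℂ^N)` in `Mat_Q(Mat_N)`, with `ℂ^N` the diagonal matrices. -/
def diagEmbed (x : Matrix q q (ι → ℂ)) : Matrix (q × ι) (q × ι) ℂ :=
  Matrix.blockDiagonal fun k => x.map fun v => v k

/-- The sequence of norms of the operator space `∩·∩{K ℓ_∞, ℓ₁}`. -/
def capCapNorm (K : ℝ) (Q : ℕ) (x : Matrix (Fin Q) (Fin Q) (ι → ℂ)) : ℝ≥0∞ :=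
  capCapMatrixNorm K (diagEmbed x)

/-- The sequence of norms of the operator space `ℓ₁`. -/
def l1MatrixNorm (Q : ℕ) (x : Matrix (Fin Q) (Fin Q) (ι → ℂ)) : ℝ≥0∞ :=
  inftyOneNorm (diagEmbed x)

/-- The conditional min-entropy (in bits) `H_min(N|Q)_ρ` of a state `ρ` on `Q ⊗ N`: minus the
logarithm of the least `t` such that `ρ ≤ t • σ ⊗ 1` for some state `σ` on `Q`. -/
def condMinEntropy (ρ : Matrix (q × ι) (q × ι) ℂ) : ℝ :=
  -Real.logb 2 (sInf {t : ℝ | ∃ σ : Matrix q q ℂ, σ.PosSemidef ∧ σ.trace = 1 ∧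
    (((t : ℂ) • (σ ⊗ₖ (1 : Matrix ι ι ℂ))) - ρ).PosSemidef})

end Quantum

/-- `f = (fₛ)ₛ` is a quantum-proof `(k, ε)`-extractor. The state `∑ₓ ρₓ ⊗ |x⟩⟨x|` is
`Matrix.blockDiagonal ρ`, its image under `id ⊗ Fₛ` is `∑ₓ ρₓ ⊗ |fₛ x⟩⟨fₛ x|`, and its marginal
on `Q` is `∑ₓ ρₓ`. -/
def IsQuantumProofExtractor {X Y S : Type*} [Fintype X] [Fintype Y] [Fintype S] [DecidableEq X]
    [DecidableEq Y] (f : S → X → Y) (k ε : ℝ) : Prop :=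
  ∀ (Q : ℕ) (ρ : X → Matrix (Fin Q) (Fin Q) ℂ),
    (∀ x, (ρ x).PosSemidef) → ∑ x, (ρ x).trace = 1 →
    k ≤ condMinEntropy (Matrix.blockDiagonal ρ) →
    traceNorm ((Fintype.card S : ℂ)⁻¹ •
        ∑ s, Matrix.blockDiagonal (fun y => ∑ x, funMatrix ℂ (f s) y x • ρ x)
      - (∑ x, ρ x) ⊗ₖ Matrix.diagonal (uniform ℂ Y)) ≤ ε

end QExt

end

noncomputable section

namespace QExt

open scoped ENNReal Kronecker ComplexOrder MatrixOrder Matrix.Norms.L2Operator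

/-! Let `D` be the real matrix of Δ[Ext] and suppose `D` maps the unit ball of ℓ_∞ into the ball of
radius `c` of ℓ₁. The heart of the matter is `traceNorm_blockDiagonal_le`: if `‖C x‖ ≤ r` and `A`,
`B` have Hilbert-Schmidt norm at most 1, the block diagonal matrix with blocks `A (∑ₓ D y x • C x)
B` has trace norm at most `K_G r c`. Pairing it with a contraction `W` that computes its trace norm
gives `∑ D y x Re tr((W_yy A)(C x B))`, a bilinear form of `D` in vectors of a Hilbert-Schmidt
space, of lengths at most 1 and `r`. The real part of the trace is a real inner product, so the real
Grothendieck constant suffices.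

For the cb norm, the input norm dominates `2^k` times the operator norm, so `r = 2^(-k)`; for `k ≤
n` the cube `[-1,1]^N` scaled by `2^(-n)` lies in the unit ball of the intersection norm, so `c =
2^n ε`.

For quantum-proofness, min-entropy gives `ρ x ≤ 2^(-k) σ`, hence `ρ x = √σ C x √σ` with `‖C x‖ ≤
2^(-k)`, and `A = B = √σ`. Extractors satisfy the ℓ_∞ to ℓ₁ bound with `c = 4 · 2^n ε`, by splitting
a vector into pieces of large mass.

Since `grothendieckConstant` is an infimum, Grothendieck's inequality itself is proved first, with
constant 8; this makes the infimum one over a nonempty set, and it is then attained. -/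

/-! ### Rademacher sums -/

/-- The sum `∑ᵢ ± uᵢ` with signs given by a point of the discrete cube. -/
def rademacherSum {d : ℕ} (u : Fin d → ℝ) (ω : Fin d → Bool) : ℝ :=
  ∑ i, (if ω i then 1 else -1) * u i

lemma sum_cube_succ {d : ℕ} (F : (Fin (d + 1) → Bool) → ℝ) :
    ∑ ω, F ω = ∑ ω : Fin d → Bool, (F (Fin.cons true ω) + F (Fin.cons false ω)) := by
  rw [← (Fin.consEquiv fun _ : Fin (d + 1) => Bool).sum_comp, Fintype.sum_prod_type]
  simp [Fin.consEquiv, Finset.sum_add_distrib]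

lemma rademacherSum_cons {d : ℕ} (u : Fin (d + 1) → ℝ) (b : Bool) (ω : Fin d → Bool) :
    rademacherSum u (Fin.cons b ω) =
      (if b then 1 else -1) * u 0 + rademacherSum (fun i => u i.succ) ω := by
  simp [rademacherSum, Fin.sum_univ_succ]

/-- Independent signs are orthonormal: cross terms cancel between the two values of the first sign.
Inner products thus become correlations of functions on the cube. -/
lemma sum_rademacherSum_mul {d : ℕ} (u v : Fin d → ℝ) :
    ∑ ω, rademacherSum u ω * rademacherSum v ω = 2 ^ d * ∑ i, u i * v i := by
  induction d with
  | zero => simp [rademacherSum]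
  | succ d ih =>
    rw [sum_cube_succ, Fin.sum_univ_succ, mul_add, pow_succ, mul_assoc (2 ^ d) 2 (∑ _, _),
      mul_left_comm (2 ^ d), ← ih, Finset.mul_sum]
    have h : (2 : ℝ) ^ d * 2 * (u 0 * v 0) = ∑ _ω : Fin d → Bool, 2 * (u 0 * v 0) := by
      simp; ring
    rw [h, ← Finset.sum_add_distrib]
    refine Finset.sum_congr rfl fun ω _ => ?_
    simp only [rademacherSum_cons, if_true, Bool.false_eq_true, if_false]
    ring

/-- Khinchin's inequality for the fourth moment, which controls what truncation removes. -/
lemma sum_rademacherSum_pow_four_le {d : ℕ} (u : Fin d → ℝ) :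
    ∑ ω, rademacherSum u ω ^ 4 ≤ 3 * 2 ^ d * (∑ i, u i ^ 2) ^ 2 := by
  induction d with
  | zero => simp [rademacherSum]
  | succ d ih =>
    have h4 := ih fun i => u i.succ
    have h2 : ∑ ω, rademacherSum (fun i => u i.succ) ω ^ 2 = 2 ^ d * ∑ i : Fin d, u i.succ ^ 2 := by
      simpa only [sq] using sum_rademacherSum_mul (fun i => u i.succ) fun i => u i.succ
    have key : ∑ ω, rademacherSum u ω ^ 4 =
        2 * ∑ ω, rademacherSum (fun i => u i.succ) ω ^ 4 +
        12 * u 0 ^ 2 * ∑ ω, rademacherSum (fun i => u i.succ) ω ^ 2 + 2 ^ d * (2 * u 0 ^ 4) := by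
      have h : (2 : ℝ) ^ d * (2 * u 0 ^ 4) = ∑ _ω : Fin d → Bool, 2 * u 0 ^ 4 := by simp
      rw [sum_cube_succ, h, Finset.mul_sum, Finset.mul_sum, ← Finset.sum_add_distrib,
        ← Finset.sum_add_distrib]
      refine Finset.sum_congr rfl fun ω _ => ?_
      simp only [rademacherSum_cons, if_true, Bool.false_eq_true, if_false]
      ring
    rw [key, h2, Fin.sum_univ_succ, pow_succ (2 : ℝ) d]
    -- The two sides differ by four times this term, once `h4` is used.
    have : (0 : ℝ) ≤ 2 ^ d * u 0 ^ 4 := by positivity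
    nlinarith

/-! ### Grothendieck's inequality -/

/-- The truncation of a real number to `[-2, 2]`. -/
def truncTwo (x : ℝ) : ℝ := max (-2) (min 2 x)

lemma abs_truncTwo_le_two (x : ℝ) : |truncTwo x| ≤ 2 := by
  rw [truncTwo, abs_le]
  exact ⟨le_max_left _ _, max_le (by norm_num) (min_le_left _ _)⟩

lemma truncTwo_sq_le (x : ℝ) : truncTwo x ^ 2 ≤ x ^ 2 := by
  rw [truncTwo]
  rcases le_total 2 x with h | h
  · rw [min_eq_left h, max_eq_right (by norm_num)]; nlinarith
  · rw [min_eq_right h]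
    rcases le_total (-2) x with h' | h'
    · rw [max_eq_right h']
    · rw [max_eq_left h']; nlinarith

/-- From `(|x| - 4)² ≥ 0` one gets `|x| - 2 ≤ x² / 8`. With fourth moment at most 3, the remainder
has squared L² norm at most 3/64, so length below 1/4. -/
lemma sub_truncTwo_sq_le (x : ℝ) : (x - truncTwo x) ^ 2 ≤ x ^ 4 / 64 := by
  rw [truncTwo]
  rcases le_total 2 x with h | h
  · rw [min_eq_left h, max_eq_right (by norm_num)]
    have h1 : x - 2 ≤ x ^ 2 / 8 := by nlinarith [sq_nonneg (x - 4)]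
    calc (x - 2) ^ 2 ≤ (x ^ 2 / 8) ^ 2 := pow_le_pow_left₀ (by linarith) h1 2
      _ = x ^ 4 / 64 := by ring
  · rw [min_eq_right h]
    rcases le_total (-2) x with h' | h'
    · rw [max_eq_right h', sub_self, zero_pow two_ne_zero]; positivity
    · rw [max_eq_left h']
      have h1 : -x - 2 ≤ x ^ 2 / 8 := by nlinarith [sq_nonneg (x + 4)]
      calc (x - -2) ^ 2 = (-x - 2) ^ 2 := by ring
        _ ≤ (x ^ 2 / 8) ^ 2 := pow_le_pow_left₀ (by linarith) h1 2
        _ = x ^ 4 / 64 := by ring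

/-- The value of the bilinear form of `A` on two families of vectors. -/
def vectorForm {I J κ : Type*} [Fintype I] [Fintype J] [Fintype κ] (A : I → J → ℝ)
    (u : I → κ → ℝ) (v : J → κ → ℝ) : ℝ :=
  ∑ i, ∑ j, A i j * ∑ k, u i k * v j k

/-- The values of the bilinear form of `A` on vectors of norm at most one. -/
def vectorValues {I J : Type*} [Fintype I] [Fintype J] (A : I → J → ℝ) : Set ℝ :=
  {r | ∃ (d : ℕ) (u : I → Fin d → ℝ) (v : J → Fin d → ℝ),
    (∀ i, ∑ k, u i k ^ 2 ≤ 1) ∧ (∀ j, ∑ k, v j k ^ 2 ≤ 1) ∧ vectorForm A u v = r}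

section Values

variable {I J κ : Type*} [Fintype I] [Fintype J] [Fintype κ] (A : I → J → ℝ)

lemma vectorForm_mem_vectorValues {u : I → κ → ℝ} {v : J → κ → ℝ}
    (hu : ∀ i, ∑ k, u i k ^ 2 ≤ 1) (hv : ∀ j, ∑ k, v j k ^ 2 ≤ 1) :
    vectorForm A u v ∈ vectorValues A := by
  let e := (Fintype.equivFin κ).symm
  refine ⟨Fintype.card κ, fun i k => u i (e k), fun j k => v j (e k), fun i => ?_, fun j => ?_, ?_⟩
  · rw [e.sum_comp fun k => u i k ^ 2]; exact hu i
  · rw [e.sum_comp fun k => v j k ^ 2]; exact hv j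
  · simp only [vectorForm]
    refine Finset.sum_congr rfl fun i _ => Finset.sum_congr rfl fun j _ => ?_
    rw [e.sum_comp fun k => u i k * v j k]

lemma bddAbove_vectorValues : BddAbove (vectorValues A) := by
  refine ⟨∑ i, ∑ j, |A i j|, ?_⟩
  rintro _ ⟨d, u, v, hu, hv, rfl⟩
  refine Finset.sum_le_sum fun i _ => Finset.sum_le_sum fun j _ => ?_
  have h : |∑ k, u i k * v j k| ≤ 1 := by
    rw [← sq_le_one_iff_abs_le_one]
    calc (∑ k, u i k * v j k) ^ 2 ≤ (∑ k, u i k ^ 2) * ∑ k, v j k ^ 2 :=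
          Finset.sum_mul_sq_le_sq_mul_sq _ _ _
      _ ≤ 1 := mul_le_one₀ (hu i) (Finset.sum_nonneg fun _ _ => sq_nonneg _) (hv j)
  calc A i j * ∑ k, u i k * v j k ≤ |A i j * ∑ k, u i k * v j k| := le_abs_self _
    _ = |A i j| * |∑ k, u i k * v j k| := abs_mul _ _
    _ ≤ |A i j| := mul_le_of_le_one_right (abs_nonneg _) h

lemma vectorForm_smul_left (t : ℝ) (u : I → κ → ℝ) (v : J → κ → ℝ) :
    vectorForm A (fun i k => t * u i k) v = t * vectorForm A u v := by
  simp only [vectorForm, Finset.mul_sum]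
  refine Finset.sum_congr rfl fun i _ => Finset.sum_congr rfl fun j _ =>
    Finset.sum_congr rfl fun k _ => by ring

lemma vectorForm_smul_right (t : ℝ) (u : I → κ → ℝ) (v : J → κ → ℝ) :
    vectorForm A u (fun j k => t * v j k) = t * vectorForm A u v := by
  simp only [vectorForm, Finset.mul_sum]
  refine Finset.sum_congr rfl fun i _ => Finset.sum_congr rfl fun j _ =>
    Finset.sum_congr rfl fun k _ => by ring

lemma vectorForm_add_left (u u' : I → κ → ℝ) (v : J → κ → ℝ) :
    vectorForm A (fun i k => u i k + u' i k) v = vectorForm A u v + vectorForm A u' v := by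
  simp only [vectorForm, add_mul, mul_add, Finset.sum_add_distrib]

lemma vectorForm_add_right (u : I → κ → ℝ) (v v' : J → κ → ℝ) :
    vectorForm A u (fun j k => v j k + v' j k) = vectorForm A u v + vectorForm A u v' := by
  simp only [vectorForm, mul_add, Finset.sum_add_distrib]

lemma vectorForm_eq_sum (u : I → κ → ℝ) (v : J → κ → ℝ) :
    vectorForm A u v = ∑ k, ∑ i, ∑ j, A i j * (u i k * v j k) := by
  simp only [vectorForm, Finset.mul_sum]
  rw [Finset.sum_comm (s := Finset.univ (α := κ))]
  exact Finset.sum_congr rfl fun i _ => Finset.sum_comm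

variable {A}

lemma sum_bilin_le_of_abs_le {c : ℝ}
    (h : ∀ (a : I → ℝ) (b : J → ℝ), (∀ i, |a i| ≤ 1) → (∀ j, |b j| ≤ 1) →
      ∑ i, ∑ j, A i j * (a i * b j) ≤ c) {M : ℝ} (hM : 0 < M) {a : I → ℝ} {b : J → ℝ}
    (ha : ∀ i, |a i| ≤ M) (hb : ∀ j, |b j| ≤ M) : ∑ i, ∑ j, A i j * (a i * b j) ≤ M ^ 2 * c := by
  have := h (fun i => a i / M) (fun j => b j / M)
    (fun i => by rw [abs_div, abs_of_pos hM]; exact (div_le_one hM).2 (ha i))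
    (fun j => by rw [abs_div, abs_of_pos hM]; exact (div_le_one hM).2 (hb j))
  calc ∑ i, ∑ j, A i j * (a i * b j) = M ^ 2 * ∑ i, ∑ j, A i j * (a i / M * (b j / M)) := by
        simp only [Finset.mul_sum]
        refine Finset.sum_congr rfl fun i _ => Finset.sum_congr rfl fun j _ => ?_
        field_simp
    _ ≤ M ^ 2 * c := by gcongr

/-- Grothendieck's inequality: truncate the Rademacher sums that realise the inner products, and
absorb the remainders, which are short vectors in `L²` of the cube, in the left-hand side. -/
theorem vectorForm_le_of_scalar {c : ℝ}
    (h : ∀ (a : I → ℝ) (b : J → ℝ), (∀ i, |a i| ≤ 1) → (∀ j, |b j| ≤ 1) →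
      ∑ i, ∑ j, A i j * (a i * b j) ≤ c)
    {r : ℝ} (hr : r ∈ vectorValues A) : r ≤ 8 * c := by
  set V := sSup (vectorValues A) with hV
  -- Taking the supremum gives `V ≤ 4 * c + V / 2`, that is `V ≤ 8 * c`, as `V` is finite.
  suffices H : ∀ r ∈ vectorValues A, r ≤ 4 * c + V / 2 by
    have hne : (vectorValues A).Nonempty := ⟨r, hr⟩
    have h1 : V ≤ 4 * c + V / 2 := csSup_le hne H
    linarith [H r hr]
  rintro _ ⟨d, u, v, hu, hv, rfl⟩
  set w : ℝ := (√(2 ^ d))⁻¹ with hw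
  have hw2 : w ^ 2 * 2 ^ d = 1 := by
    rw [hw, inv_pow, Real.sq_sqrt (by positivity)]; field_simp
  have hl2 : ∀ x : Fin d → ℝ, ∑ k, x k ^ 2 ≤ 1 → ∑ ω, (w * rademacherSum x ω) ^ 2 ≤ 1 := by
    intro x hx
    have := sum_rademacherSum_mul x x
    simp only [mul_pow, ← Finset.mul_sum]
    simp only [← sq] at this
    rw [this, ← mul_assoc, hw2, one_mul]
    exact hx
  have htr : ∀ x : Fin d → ℝ, ∑ k, x k ^ 2 ≤ 1 →
      ∑ ω, (w * truncTwo (rademacherSum x ω)) ^ 2 ≤ 1 := by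
    intro x hx
    refine (Finset.sum_le_sum fun ω _ => ?_).trans (hl2 x hx)
    rw [mul_pow, mul_pow]
    exact mul_le_mul_of_nonneg_left (truncTwo_sq_le _) (sq_nonneg _)
  have hrem : ∀ x : Fin d → ℝ, ∑ k, x k ^ 2 ≤ 1 →
      ∑ ω, (4 * (w * (rademacherSum x ω - truncTwo (rademacherSum x ω)))) ^ 2 ≤ 1 := by
    intro x hx
    calc ∑ ω, (4 * (w * (rademacherSum x ω - truncTwo (rademacherSum x ω)))) ^ 2
        ≤ ∑ ω, w ^ 2 / 4 * rademacherSum x ω ^ 4 := by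
          refine Finset.sum_le_sum fun ω _ => ?_
          have := mul_le_mul_of_nonneg_left (sub_truncTwo_sq_le (rademacherSum x ω)) (sq_nonneg w)
          rw [mul_pow, mul_pow]
          linarith
      _ = w ^ 2 / 4 * ∑ ω, rademacherSum x ω ^ 4 := by rw [Finset.mul_sum]
      _ ≤ w ^ 2 / 4 * (3 * 2 ^ d * (∑ k, x k ^ 2) ^ 2) :=
          mul_le_mul_of_nonneg_left (sum_rademacherSum_pow_four_le x) (by positivity)
      _ = 3 / 4 * (w ^ 2 * 2 ^ d) * (∑ k, x k ^ 2) ^ 2 := by ring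
      _ ≤ 1 := by
          rw [hw2]
          have : (∑ k, x k ^ 2) ^ 2 ≤ 1 :=
            pow_le_one₀ (Finset.sum_nonneg fun _ _ => sq_nonneg _) hx
          linarith
  have hle : ∀ {x : I → (Fin d → Bool) → ℝ} {y : J → (Fin d → Bool) → ℝ},
      (∀ i, ∑ k, x i k ^ 2 ≤ 1) → (∀ j, ∑ k, y j k ^ 2 ≤ 1) → vectorForm A x y ≤ V :=
    fun hx hy => le_csSup (bddAbove_vectorValues A) (vectorForm_mem_vectorValues A hx hy)
  -- With T for truncation, `⟨x, y⟩ = ⟨Tx, Ty⟩ + ⟨Tx, y - Ty⟩ + ⟨x - Tx, y⟩`; each of the last two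
  -- terms contributes at most `V / 4`.
  have hsplit : vectorForm A u v =
      vectorForm A (fun i ω => w * truncTwo (rademacherSum (u i) ω))
          (fun j ω => w * truncTwo (rademacherSum (v j) ω)) +
        vectorForm A (fun i ω => w * truncTwo (rademacherSum (u i) ω))
          (fun j ω => w * (rademacherSum (v j) ω - truncTwo (rademacherSum (v j) ω))) +
        vectorForm A (fun i ω => w * (rademacherSum (u i) ω - truncTwo (rademacherSum (u i) ω)))
          (fun j ω => w * rademacherSum (v j) ω) := by
    rw [← vectorForm_add_right]
    simp only [← mul_add, add_sub_cancel]
    rw [← vectorForm_add_left]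
    simp only [← mul_add, add_sub_cancel]
    simp only [vectorForm]
    refine Finset.sum_congr rfl fun i _ => Finset.sum_congr rfl fun j _ => ?_
    congr 1
    calc ∑ k, u i k * v j k = w ^ 2 * (2 ^ d * ∑ k, u i k * v j k) := by
          rw [← mul_assoc, hw2, one_mul]
      _ = _ := by
          rw [← sum_rademacherSum_mul, Finset.mul_sum]
          exact Finset.sum_congr rfl fun ω _ => by ring
  -- At each point of the cube the entries are scalars in [-2, 2], which costs a factor 2²; the
  -- weights `w ^ 2` sum to 1.
  have h1 : vectorForm A (fun i ω => w * truncTwo (rademacherSum (u i) ω))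
      (fun j ω => w * truncTwo (rademacherSum (v j) ω)) ≤ 4 * c := by
    rw [vectorForm_smul_left, vectorForm_smul_right, vectorForm_eq_sum]
    have : ∀ ω : Fin d → Bool, ∑ i, ∑ j,
        A i j * (truncTwo (rademacherSum (u i) ω) * truncTwo (rademacherSum (v j) ω)) ≤ 2 ^ 2 * c :=
      fun ω => sum_bilin_le_of_abs_le h two_pos (fun i => abs_truncTwo_le_two _)
        fun j => abs_truncTwo_le_two _
    have hs := Finset.sum_le_sum fun ω (_ : ω ∈ Finset.univ (α := Fin d → Bool)) => this ω
    have hc : ∑ _ω : Fin d → Bool, (2 : ℝ) ^ 2 * c = 2 ^ d * (4 * c) := by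
      simp only [Finset.sum_const, Finset.card_univ, Fintype.card_fun, Fintype.card_bool,
        Fintype.card_fin, nsmul_eq_mul]
      push_cast
      ring
    rw [hc] at hs
    calc _ = w ^ 2 * _ := by rw [← mul_assoc, ← sq]
      _ ≤ w ^ 2 * (2 ^ d * (4 * c)) := mul_le_mul_of_nonneg_left hs (sq_nonneg w)
      _ = 4 * c := by rw [← mul_assoc, hw2, one_mul]
  have h2 := hle (fun i => htr (u i) (hu i)) fun j => hrem (v j) (hv j)
  have h3 := hle (fun i => hrem (u i) (hu i)) fun j => hl2 (v j) (hv j)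
  rw [vectorForm_smul_right A 4] at h2
  rw [vectorForm_smul_left A 4] at h3
  linarith

end Values

theorem isGrothendieckBound_eight : IsGrothendieckBound 8 := by
  intro p q A c h d a b ha hb
  have hn : ∀ x : EuclideanSpace ℝ (Fin d), ‖x‖ ≤ 1 → ∑ k, x k ^ 2 ≤ 1 := by
    intro x hx
    rw [← EuclideanSpace.real_norm_sq_eq]
    exact pow_le_one₀ (norm_nonneg _) hx
  refine vectorForm_le_of_scalar (A := A) h
    ⟨d, fun i k => a i k, fun j k => b j k, fun i => hn _ (ha i), fun j => hn _ (hb j), ?_⟩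
  simp only [vectorForm, PiLp.inner_apply, RCLike.inner_apply, conj_trivial, mul_comm]

/-! ### The Grothendieck constant as an attained infimum -/

lemma IsGrothendieckBound.one_le {K : ℝ} (hK : IsGrothendieckBound K) : 1 ≤ K := by
  have := hK 1 1 (fun _ _ => 1) 1 (fun a b ha hb => by
      simp only [Finset.univ_unique, Finset.sum_singleton, one_mul]
      calc _ ≤ |a default * b default| := le_abs_self _
        _ = |a default| * |b default| := abs_mul _ _
        _ ≤ 1 := mul_le_one₀ (ha _) (abs_nonneg _) (hb _))
    1 (fun _ => EuclideanSpace.single 0 1) (fun _ => EuclideanSpace.single 0 1)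
    (by simp) (by simp)
  simpa using this

lemma one_le_grothendieckConstant : 1 ≤ grothendieckConstant :=
  le_csInf ⟨8, isGrothendieckBound_eight⟩ fun _ hK => IsGrothendieckBound.one_le hK

lemma grothendieckConstant_nonneg : 0 ≤ grothendieckConstant :=
  zero_le_one.trans one_le_grothendieckConstant

/-- The Grothendieck constant is attained. -/
theorem isGrothendieckBound_grothendieckConstant : IsGrothendieckBound grothendieckConstant := by
  intro p q A c h d a b ha hb
  have hc : 0 ≤ c := by simpa using h 0 0 (by simp) (by simp)
  -- One cannot divide by `c = 0`, but there every constant gives the same bound, so 8 will do.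
  rcases hc.eq_or_lt with rfl | hc
  · simpa using isGrothendieckBound_eight p q A 0 h d a b ha hb
  · rw [← div_le_iff₀ hc]
    refine le_csInf ⟨8, isGrothendieckBound_eight⟩ fun K hK => ?_
    rw [div_le_iff₀ hc]
    exact hK p q A c h d a b ha hb

/-- Grothendieck's inequality with arbitrary finite index types. -/
theorem vectorForm_le_grothendieckConstant_mul {I J κ : Type*} [Fintype I] [Fintype J] [Fintype κ]
    {A : I → J → ℝ} {c : ℝ}
    (h : ∀ (a : I → ℝ) (b : J → ℝ), (∀ i, |a i| ≤ 1) → (∀ j, |b j| ≤ 1) →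
      ∑ i, ∑ j, A i j * (a i * b j) ≤ c) {u : I → κ → ℝ} {v : J → κ → ℝ}
    (hu : ∀ i, ∑ k, u i k ^ 2 ≤ 1) (hv : ∀ j, ∑ k, v j k ^ 2 ≤ 1) :
    vectorForm A u v ≤ grothendieckConstant * c := by
  obtain ⟨d, u', v', hu', hv', he⟩ := vectorForm_mem_vectorValues A hu hv
  let e := (Fintype.equivFin I).symm
  let e' := (Fintype.equivFin J).symm
  have hn : ∀ x : Fin d → ℝ, ∑ k, x k ^ 2 ≤ 1 →
      ‖(WithLp.toLp 2 x : EuclideanSpace ℝ (Fin d))‖ ≤ 1 := by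
    intro x hx
    rw [← sq_le_one_iff₀ (norm_nonneg _), EuclideanSpace.real_norm_sq_eq]
    exact hx
  have := isGrothendieckBound_grothendieckConstant _ _ (fun i j => A (e i) (e' j)) c
    (fun a b ha hb => ?_) d (fun i => WithLp.toLp 2 (u' (e i))) (fun j => WithLp.toLp 2 (v' (e' j)))
    (fun i => hn _ (hu' _)) (fun j => hn _ (hv' _))
  · refine le_of_eq_of_le ?_ this
    rw [← he, vectorForm, ← e.sum_comp]
    refine Finset.sum_congr rfl fun i _ => ?_
    rw [← e'.sum_comp]
    simp only [PiLp.inner_apply, RCLike.inner_apply, conj_trivial, mul_comm]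
  · refine le_of_eq_of_le ?_ (h (fun i => a (e.symm i)) (fun j => b (e'.symm j)) (fun i => ha _)
      fun j => hb _)
    rw [← e.sum_comp]
    refine Finset.sum_congr rfl fun i _ => ?_
    rw [← e'.sum_comp]
    simp

/-! ### Hilbert-Schmidt norm, trace norm and operator norm -/

section HilbertSchmidt

variable {q : Type*} [Fintype q]

/-- The square of the Hilbert-Schmidt norm. -/
def hsSq (A : Matrix q q ℂ) : ℝ := ∑ i, ∑ j, ‖A i j‖ ^ 2

lemma trace_conjTranspose_mul_self_re (A : Matrix q q ℂ) :
    (A.conjTranspose * A).trace.re = hsSq A := by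
  rw [hsSq, Finset.sum_comm, Matrix.trace, Complex.re_sum]
  refine Finset.sum_congr rfl fun j _ => ?_
  rw [Matrix.diag_apply, Matrix.mul_apply, Complex.re_sum]
  refine Finset.sum_congr rfl fun i _ => ?_
  rw [Matrix.conjTranspose_apply, ← Complex.normSq_eq_norm_sq, Complex.normSq_apply]
  simp

lemma hsSq_le_one_of_hsNorm_le_one [DecidableEq q] {A : Matrix q q ℂ} (h : hsNorm A ≤ 1) :
    hsSq A ≤ 1 := by
  rw [hsNorm, trace_conjTranspose_mul_self_re, Real.sqrt_le_one] at h
  exact h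

lemma hsSq_nonneg (A : Matrix q q ℂ) : 0 ≤ hsSq A :=
  Finset.sum_nonneg fun _ _ => Finset.sum_nonneg fun _ _ => sq_nonneg _

/-- Grothendieck's inequality for vectors in the Hilbert-Schmidt space. -/
theorem sum_mul_trace_le {X Y : Type*} [Fintype X] [Fintype Y] {D : Y → X → ℝ} {c : ℝ}
    (h : ∀ (a : Y → ℝ) (b : X → ℝ), (∀ i, |a i| ≤ 1) → (∀ j, |b j| ≤ 1) →
      ∑ i, ∑ j, D i j * (a i * b j) ≤ c) {U : Y → Matrix q q ℂ} {V : X → Matrix q q ℂ}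
    (hU : ∀ y, hsSq (U y) ≤ 1) (hV : ∀ x, hsSq (V x) ≤ 1) :
    ∑ y, ∑ x, D y x * (U y * V x).trace.re ≤ grothendieckConstant * c := by
  have hns : ∀ z : ℂ, ‖z‖ ^ 2 = z.re ^ 2 + z.im ^ 2 := fun z => by
    rw [Complex.sq_norm, Complex.normSq_apply, sq, sq]
  -- Real coordinates chosen so that `Re tr(UV)` is their inner product: `V` is transposed, and the
  -- sign comes from `Re(zw) = Re z Re w - Im z Im w`.
  let u : Y → (q × q) ⊕ (q × q) → ℝ := fun y =>
    Sum.elim (fun p => (U y p.1 p.2).re) fun p => -(U y p.1 p.2).im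
  let v : X → (q × q) ⊕ (q × q) → ℝ := fun x =>
    Sum.elim (fun p => (V x p.2 p.1).re) fun p => (V x p.2 p.1).im
  have hu : ∀ y, ∑ k, u y k ^ 2 ≤ 1 := by
    intro y
    refine le_of_eq_of_le ?_ (hU y)
    simp only [u, Fintype.sum_sum_type, Sum.elim_inl, Sum.elim_inr, Fintype.sum_prod_type, hsSq,
      ← Finset.sum_add_distrib, hns, neg_sq]
  have hv : ∀ x, ∑ k, v x k ^ 2 ≤ 1 := by
    intro x
    refine le_of_eq_of_le ?_ (hV x)
    rw [hsSq, Finset.sum_comm]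
    simp only [v, Fintype.sum_sum_type, Sum.elim_inl, Sum.elim_inr, Fintype.sum_prod_type,
      ← Finset.sum_add_distrib, hns]
  refine le_of_eq_of_le ?_ (vectorForm_le_grothendieckConstant_mul h hu hv)
  simp only [vectorForm]
  refine Finset.sum_congr rfl fun y _ => Finset.sum_congr rfl fun x _ => ?_
  congr 1
  simp only [u, v, Fintype.sum_sum_type, Sum.elim_inl, Sum.elim_inr, Fintype.sum_prod_type,
    ← Finset.sum_add_distrib, Matrix.trace, Matrix.diag_apply, Matrix.mul_apply, Complex.re_sum,
    Complex.mul_re]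
  refine Finset.sum_congr rfl fun i _ => Finset.sum_congr rfl fun j _ => by ring

end HilbertSchmidt

section DiagBlock

variable {ι q : Type*}

/-- The diagonal block with index `y` of a matrix on `ℂ^q ⊗ ℂ^ι`. -/
def diagBlock (W : Matrix (q × ι) (q × ι) ℂ) (y : ι) : Matrix q q ℂ :=
  W.submatrix (fun i => (i, y)) fun i => (i, y)

lemma trace_mul_blockDiagonal [Fintype ι] [DecidableEq ι] [Fintype q]
    (W : Matrix (q × ι) (q × ι) ℂ) (Z : ι → Matrix q q ℂ) :
    (W * Matrix.blockDiagonal Z).trace = ∑ y, (diagBlock W y * Z y).trace := by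
  simp only [Matrix.trace, Matrix.diag_apply, Matrix.mul_apply, Fintype.sum_prod_type,
    Matrix.blockDiagonal_apply, diagBlock, Matrix.submatrix_apply]
  rw [Finset.sum_comm]
  refine Finset.sum_congr rfl fun y _ => Finset.sum_congr rfl fun i _ =>
    Finset.sum_congr rfl fun j _ => ?_
  simp

end DiagBlock

section Norms

variable {ι q : Type*} [Fintype ι] [DecidableEq ι] [Fintype q] [DecidableEq q]

/-- A functional calculus version of the polar decomposition. -/
theorem exists_contraction_traceNorm_eq (A : Matrix ι ι ℂ) :
    ∃ W : Matrix ι ι ℂ, ‖W‖ ≤ 1 ∧ traceNorm A = (W * A).trace.re := by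
  set H : Matrix ι ι ℂ := A.conjTranspose * A with hH
  have hpos : 0 ≤ H := star_mul_self_nonneg A
  have hsa : IsSelfAdjoint H := IsSelfAdjoint.of_nonneg hpos
  have hcont : ∀ g : ℝ → ℝ, ContinuousOn g (spectrum ℝ H) := fun g =>
    (Matrix.finite_real_spectrum (A := H)).continuousOn g
  have hspec : ∀ t ∈ spectrum ℝ H, 0 ≤ t := fun t ht => spectrum_nonneg_of_nonneg hpos ht
  -- As `0⁻¹ = 0`, this is the pseudo-inverse square root, so `A` need not be invertible. Its
  -- discontinuity at 0 is harmless because the spectrum is finite.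
  let g : ℝ → ℝ := fun t => (√t)⁻¹
  refine ⟨cfc g H * A.conjTranspose, ?_, ?_⟩
  · have hg : star (cfc g H) = cfc g H := (cfc_predicate g H : IsSelfAdjoint _).star_eq
    have hW : star (star (cfc g H * A.conjTranspose)) * star (cfc g H * A.conjTranspose) =
        cfc (fun t => g t * t * g t) H := by
      rw [star_star, star_mul, hg, Matrix.star_eq_conjTranspose, Matrix.conjTranspose_conjTranspose,
        cfc_mul (fun t => g t * t) g H (hcont _) (hcont _),
        cfc_mul g (fun t => t) H (hcont _) (hcont _), cfc_id' ℝ H]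
      simp only [hH, mul_assoc]
    have hn : ‖cfc (fun t => g t * t * g t) H‖ ≤ 1 := by
      refine norm_cfc_le zero_le_one fun t ht => ?_
      have h0 := hspec t ht
      have : g t * t * g t = (√t * (√t)⁻¹) ^ 2 := by
        simp only [g]
        nth_rw 2 [← Real.mul_self_sqrt h0]
        ring
      rw [this, Real.norm_eq_abs, abs_of_nonneg (sq_nonneg _)]
      exact pow_le_one₀ (by positivity) mul_inv_le_one
    rw [← hW, CStarRing.norm_star_mul_self, norm_star] at hn
    nlinarith [norm_nonneg (cfc g H * A.conjTranspose)]
  · rw [traceNorm, mul_assoc, ← hH, CFC.sqrt_eq_real_sqrt H hpos, 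
      cfcₙ_eq_cfc (hf := Real.continuous_sqrt.continuousOn)]
    congr 2
    have : cfc g H * H = cfc (fun t => g t * t) H := by
      rw [cfc_mul g (fun t => t) H (hcont _) (hcont _), cfc_id' ℝ H]
    rw [this]
    refine cfc_congr fun t ht => ?_
    have h0 := hspec t ht
    simp only [g]
    rcases h0.eq_or_lt with rfl | h0
    · simp
    · rw [inv_mul_eq_div, Real.div_sqrt]

/-- The operator norm bound is applied to each column of `A`. -/
lemma hsSq_mul_le (W A : Matrix q q ℂ) : hsSq (W * A) ≤ ‖W‖ ^ 2 * hsSq A := by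
  rw [hsSq, hsSq, Finset.sum_comm, Finset.sum_comm (γ := q) (s := Finset.univ) (t := Finset.univ)
    (f := fun i j => ‖A i j‖ ^ 2), Finset.mul_sum]
  refine Finset.sum_le_sum fun j _ => ?_
  have h := Matrix.l2_opNorm_mulVec W (WithLp.toLp 2 fun i => A i j)
  have h2 := pow_le_pow_left₀ (norm_nonneg _) h 2
  rw [mul_pow, EuclideanSpace.norm_sq_eq, EuclideanSpace.norm_sq_eq] at h2
  exact h2

lemma norm_diagBlock_le (W : Matrix (q × ι) (q × ι) ℂ) (y : ι) : ‖diagBlock W y‖ ≤ ‖W‖ := by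
  set E : Matrix (q × ι) q ℂ := (1 : Matrix (q × ι) (q × ι) ℂ).submatrix id fun i => (i, y) with hE
  have hEE : E.conjTranspose * E = 1 := by
    ext i j
    simp [hE, Matrix.mul_apply, Matrix.one_apply]
  have hnE : ‖E‖ ≤ 1 := by
    have h := Matrix.l2_opNorm_conjTranspose_mul_self E
    rw [hEE] at h
    have h1 : ‖(1 : Matrix q q ℂ)‖ ≤ 1 := by
      -- For empty `q` the identity has norm 0.
      rcases subsingleton_or_nontrivial (Matrix q q ℂ) with _ | _
      · rw [Subsingleton.elim (1 : Matrix q q ℂ) 0, norm_zero]; exact zero_le_one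
      · exact norm_one.le
    nlinarith [norm_nonneg E]
  have hW : diagBlock W y = E.conjTranspose * W * E := by
    ext i j
    simp [hE, diagBlock, Matrix.mul_apply, Matrix.one_apply]
  rw [hW]
  calc ‖E.conjTranspose * W * E‖ ≤ ‖E.conjTranspose * W‖ * ‖E‖ := Matrix.l2_opNorm_mul _ _
    _ ≤ ‖E.conjTranspose‖ * ‖W‖ * ‖E‖ := by gcongr; exact Matrix.l2_opNorm_mul _ _
    _ ≤ 1 * ‖W‖ * 1 := by rw [Matrix.l2_opNorm_conjTranspose]; gcongr
    _ = ‖W‖ := by ring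

variable {X Y : Type*} [Fintype X] [Fintype Y] [DecidableEq Y]

/-- A real matrix which is bounded from `ℓ_∞` to `ℓ₁` is completely bounded, with an additional
factor given by the real Grothendieck constant. -/
theorem traceNorm_blockDiagonal_le {D : Y → X → ℝ} {c : ℝ}
    (h : ∀ (a : Y → ℝ) (b : X → ℝ), (∀ i, |a i| ≤ 1) → (∀ j, |b j| ≤ 1) →
      ∑ i, ∑ j, D i j * (a i * b j) ≤ c) {A B : Matrix q q ℂ} (hA : hsSq A ≤ 1) (hB : hsSq B ≤ 1)
    {C : X → Matrix q q ℂ} {r : ℝ} (hr : 0 < r) (hC : ∀ x, ‖C x‖ ≤ r) :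
    traceNorm (Matrix.blockDiagonal fun y => A * (∑ x, (D y x : ℂ) • C x) * B) ≤
      grothendieckConstant * (r * c) := by
  obtain ⟨W, hW, hWt⟩ :=
    exists_contraction_traceNorm_eq (Matrix.blockDiagonal fun y => A * (∑ x, (D y x : ℂ) • C x) * B)
  rw [hWt, trace_mul_blockDiagonal, Complex.re_sum]
  -- The scale `r` is moved from `C` to `D`, so that all vectors have length at most 1.
  have h' : ∀ (a : Y → ℝ) (b : X → ℝ), (∀ i, |a i| ≤ 1) → (∀ j, |b j| ≤ 1) →
      ∑ i, ∑ j, r * D i j * (a i * b j) ≤ r * c := by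
    intro a b ha hb
    simp only [mul_assoc, ← Finset.mul_sum]
    exact mul_le_mul_of_nonneg_left (h a b ha hb) hr.le
  have hU : ∀ y, hsSq (diagBlock W y * A) ≤ 1 := fun y => (hsSq_mul_le _ _).trans <|
    mul_le_one₀ (pow_le_one₀ (norm_nonneg _) ((norm_diagBlock_le W y).trans hW)) (hsSq_nonneg _) hA
  have hV : ∀ x, hsSq (((r⁻¹ : ℝ) : ℂ) • C x * B) ≤ 1 := fun x => (hsSq_mul_le _ _).trans <| by
    refine mul_le_one₀ (pow_le_one₀ (norm_nonneg _) ?_) (hsSq_nonneg _) hB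
    rw [norm_smul, Complex.norm_real, Real.norm_eq_abs, abs_of_pos (inv_pos.2 hr), inv_mul_eq_div,
      div_le_one hr]
    exact hC x
  refine le_of_eq_of_le ?_ (sum_mul_trace_le h' hU hV)
  refine Finset.sum_congr rfl fun y _ => ?_
  simp only [Finset.mul_sum, Finset.sum_mul, Matrix.trace_sum, Complex.re_sum]
  refine Finset.sum_congr rfl fun x _ => ?_
  simp only [Matrix.smul_mul, Matrix.mul_smul, Matrix.trace_smul, smul_eq_mul,
    Complex.re_ofReal_mul, mul_assoc]
  field_simp

end Norms

/-! ### The matrix of the extractor map -/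

section ExtMatrix

variable {X Y S : Type*} [Fintype X] [Fintype Y] [Fintype S] [DecidableEq Y]

/-- The matrix of `extMap 𝕜 f`. -/
def extMatrix (𝕜 : Type*) [RCLike 𝕜] (f : S → X → Y) (y : Y) (x : X) : 𝕜 :=
  (Fintype.card S : 𝕜)⁻¹ * ∑ s, funMatrix 𝕜 (f s) y x - (Fintype.card Y : 𝕜)⁻¹

lemma ofReal_extMatrix (f : S → X → Y) (y : Y) (x : X) :
    ((extMatrix ℝ f y x : ℝ) : ℂ) = extMatrix ℂ f y x := by
  simp [extMatrix, funMatrix]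

lemma extMap_apply (𝕜 : Type*) [RCLike 𝕜] (f : S → X → Y) (v : X → 𝕜) (y : Y) :
    extMap 𝕜 f v y = ∑ x, extMatrix 𝕜 f y x * v x := by
  simp only [extMap, extMatrix, uniform, LinearMap.sub_apply, LinearMap.smul_apply,
    LinearMap.sum_apply, LinearMap.comp_apply, LinearMap.toSpanSingleton_apply, Pi.sub_apply,
    Pi.smul_apply, Finset.sum_apply, LinearMap.proj_apply, Matrix.mulVecLin_apply, Matrix.mulVec,
    dotProduct, smul_eq_mul, sub_mul, Finset.sum_sub_distrib, Finset.sum_mul, Finset.mul_sum]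
  rw [Finset.sum_comm]
  simp only [mul_assoc, mul_comm (v _)]

lemma extMap_ofReal (f : S → X → Y) (P : X → ℝ) (y : Y) :
    extMap ℂ f (fun x => (P x : ℂ)) y = ((extMap ℝ f P y : ℝ) : ℂ) := by
  rw [extMap_apply, extMap_apply]
  push_cast
  simp only [ofReal_extMatrix]

lemma boundedNorm_real_le_complex (f : S → X → Y) (K : ℝ) :
    boundedNorm (capNorm K) l1Norm (extMap ℝ f) ≤ boundedNorm (capNorm K) l1Norm (extMap ℂ f) := by
  refine iSup₂_le fun P hP => ?_
  have hn : ‖fun x => (P x : ℂ)‖ = ‖P‖ := by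
    simp only [Pi.norm_def, nnnorm, Complex.norm_real]
  have h1 : capNorm K (fun x => (P x : ℂ)) = capNorm K P := by
    simp only [capNorm, hn, Complex.norm_real]
  have h2 : l1Norm (extMap ℂ f fun x => (P x : ℂ)) = l1Norm (extMap ℝ f P) := by
    simp only [l1Norm, extMap_ofReal, Complex.norm_real]
  rw [← h2]
  exact le_iSup₂ (f := fun (x : X → ℂ) (_ : capNorm K x ≤ 1) => l1Norm (extMap ℂ f x)) _
    (h1.trans_le hP)

/-- A bound from `ℓ_∞` to `ℓ₁` is a bound on the bilinear form. -/
lemma sum_bilin_le_of_sum_abs_le {D : Y → X → ℝ} {c : ℝ}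
    (h : ∀ b : X → ℝ, (∀ x, |b x| ≤ 1) → ∑ y, |∑ x, D y x * b x| ≤ c) (a : Y → ℝ) (b : X → ℝ)
    (ha : ∀ y, |a y| ≤ 1) (hb : ∀ x, |b x| ≤ 1) : ∑ y, ∑ x, D y x * (a y * b x) ≤ c := by
  refine (Finset.sum_le_sum fun y _ => ?_).trans (h b hb)
  calc ∑ x, D y x * (a y * b x) = a y * ∑ x, D y x * b x := by
        rw [Finset.mul_sum]; exact Finset.sum_congr rfl fun x _ => by ring
    _ ≤ |a y * ∑ x, D y x * b x| := le_abs_self _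
    _ = |a y| * |∑ x, D y x * b x| := abs_mul _ _
    _ ≤ |∑ x, D y x * b x| := mul_le_of_le_one_left (abs_nonneg _) (ha y)

/-- The vector `b / |X|` lies in the unit ball of `capNorm K` because `K ≤ |X|`. The maximum with 0
reflects that `ENNReal.ofReal` truncates negative `ε`. -/
lemma sum_abs_extMatrix_le_of_boundedNorm_le [Nonempty X] {f : S → X → Y} {K ε : ℝ}
    (hKX : K ≤ Fintype.card X)
    (h : boundedNorm (capNorm K) l1Norm (extMap ℝ f) ≤ ENNReal.ofReal ε) (b : X → ℝ)
    (hb : ∀ x, |b x| ≤ 1) :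
    ∑ y, |∑ x, extMatrix ℝ f y x * b x| ≤ Fintype.card X * max ε 0 := by
  set N : ℝ := (Fintype.card X : ℝ) with hN
  have hN0 : 0 < N := by rw [hN]; exact_mod_cast Fintype.card_pos
  have hcap : capNorm K (N⁻¹ • b) ≤ 1 := by
    rw [capNorm, ENNReal.ofReal_le_one]
    refine max_le ?_ ?_
    · have : ‖b‖ ≤ 1 := (pi_norm_le_iff_of_nonneg zero_le_one).2 hb
      rw [norm_smul, Real.norm_eq_abs, abs_of_pos (inv_pos.2 hN0), ← mul_assoc, ← div_eq_mul_inv]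
      exact mul_le_one₀ ((div_le_one hN0).2 hKX) (norm_nonneg _) this
    · calc ∑ x, ‖(N⁻¹ • b) x‖ ≤ ∑ _x : X, N⁻¹ := by
            refine Finset.sum_le_sum fun x _ => ?_
            rw [Pi.smul_apply, norm_smul, Real.norm_eq_abs, abs_of_pos (inv_pos.2 hN0)]
            exact mul_le_of_le_one_right (inv_pos.2 hN0).le (hb x)
        _ = 1 := by
            rw [Finset.sum_const, Finset.card_univ, nsmul_eq_mul, ← hN, mul_inv_cancel₀ hN0.ne']
  have h1 := (le_iSup₂ (f := fun (x : X → ℝ) (_ : capNorm K x ≤ 1) => l1Norm (extMap ℝ f x)) _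
    hcap).trans h
  rw [map_smul] at h1
  simp only [l1Norm, Pi.smul_apply, extMap_apply, smul_eq_mul, norm_mul,
    Real.norm_eq_abs, abs_of_pos (inv_pos.2 hN0), ← Finset.mul_sum] at h1
  rw [← div_le_iff₀' hN0, div_eq_inv_mul, le_max_iff]
  exact ENNReal.ofReal_le_ofReal_iff'.1 h1

/-! ### The completely bounded norm -/

/-- Only the operator norm half of each maximum is kept; the `gammaMap` terms are dropped. -/
lemma ofReal_mul_norm_le_capCapMatrixNorm {ι q : Type*} [Fintype ι] [DecidableEq ι] [Fintype q]
    [DecidableEq q] {K : ℝ} (hK : 0 ≤ K) (x : Matrix (q × ι) (q × ι) ℂ) :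
    ENNReal.ofReal (K * ‖x‖) ≤ capCapMatrixNorm K x := by
  refine le_iInf fun a => le_iInf fun b => le_iInf fun hx => ENNReal.ofReal_le_ofReal ?_
  calc K * ‖x‖ ≤ (√K * √K) * (‖a‖ * ‖b‖) := by
        rw [Real.mul_self_sqrt hK, hx, ← Matrix.l2_opNorm_conjTranspose b]
        exact mul_le_mul_of_nonneg_left (Matrix.l2_opNorm_mul _ _) hK
    _ = (√K * ‖a‖) * (√K * ‖b‖) := by ring
    _ ≤ _ := by gcongr <;> exact le_max_left _ _

variable [DecidableEq X]

theorem cbNorm_extMap_le (f : S → X → Y) {K c : ℝ} (hK : 0 < K)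
    (h : ∀ b : X → ℝ, (∀ x, |b x| ≤ 1) → ∑ y, |∑ x, extMatrix ℝ f y x * b x| ≤ c) :
    cbNorm (capCapNorm K) l1MatrixNorm (extMap ℂ f) ≤
      ENNReal.ofReal (grothendieckConstant * (K⁻¹ * c)) := by
  refine iSup_le fun Q => iSup₂_le fun x hx => iSup₂_le fun A B => iSup₂_le fun hA hB =>
    ENNReal.ofReal_le_ofReal ?_
  have hnorm : K * ‖diagEmbed x‖ ≤ 1 := by
    rw [← ENNReal.ofReal_le_one]
    exact (ofReal_mul_norm_le_capCapMatrixNorm hK.le _).trans hx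
  have hC : ∀ k : X, ‖x.map fun v => v k‖ ≤ K⁻¹ := by
    intro k
    have : (x.map fun v => v k) = diagBlock (diagEmbed x) k := by
      ext i j; simp [diagBlock, diagEmbed, Matrix.blockDiagonal_apply]
    rw [this]
    refine (norm_diagBlock_le _ _).trans ?_
    rw [← one_div, le_div_iff₀' hK]
    exact hnorm
  refine le_of_eq_of_le ?_ (traceNorm_blockDiagonal_le (sum_bilin_le_of_sum_abs_le h)
    (hsSq_le_one_of_hsNorm_le_one hA) (hsSq_le_one_of_hsNorm_le_one hB) (inv_pos.2 hK) hC)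
  rw [Matrix.kronecker_one, Matrix.kronecker_one, diagEmbed, ← Matrix.blockDiagonal_mul,
    ← Matrix.blockDiagonal_mul]
  congr 2
  ext1 y
  congr 2
  ext i j
  simp only [Matrix.map_apply, extMap_apply, Matrix.sum_apply, Matrix.smul_apply, smul_eq_mul,
    ofReal_extMatrix]

end ExtMatrix

/-! ### Extractors -/

section Extractor

variable {X Y S : Type*} [Fintype X] [Fintype Y] [Fintype S] [DecidableEq Y]

/-- Normalising `p` by its mass `s ≥ 2^k` gives a distribution with entries at most `1 / s ≤
2^(-k)`, so the extractor property applies. -/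
lemma sum_abs_extMatrix_le_mul_of_isExtractor {f : S → X → Y} {k ε : ℝ} (h : IsExtractor f k ε)
    {p : X → ℝ} (hp0 : ∀ x, 0 ≤ p x) (hp1 : ∀ x, p x ≤ 1) (hs : (2 : ℝ) ^ k ≤ ∑ x, p x) :
    ∑ y, |∑ x, extMatrix ℝ f y x * p x| ≤ (∑ x, p x) * ε := by
  set s := ∑ x, p x with hsdef
  have h2k : (0 : ℝ) < 2 ^ k := Real.rpow_pos_of_pos two_pos k
  have hs0 : 0 < s := h2k.trans_le hs
  have hsum : ∑ x, (s⁻¹ • p) x = 1 := by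
    simp only [Pi.smul_apply, smul_eq_mul, ← Finset.mul_sum]
    exact inv_mul_cancel₀ hs0.ne'
  have hmem : s⁻¹ • p ∈ stdSimplex ℝ X :=
    ⟨fun x => mul_nonneg (inv_pos.2 hs0).le (hp0 x), hsum⟩
  have hnorm : ‖s⁻¹ • p‖ ≤ (2 : ℝ) ^ (-k) := by
    have : ‖p‖ ≤ 1 := (pi_norm_le_iff_of_nonneg zero_le_one).2 fun x => by
      rw [Real.norm_eq_abs, abs_of_nonneg (hp0 x)]; exact hp1 x
    rw [norm_smul, Real.norm_eq_abs, abs_of_pos (inv_pos.2 hs0), Real.rpow_neg two_pos.le]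
    calc s⁻¹ * ‖p‖ ≤ s⁻¹ := mul_le_of_le_one_right (inv_pos.2 hs0).le this
      _ ≤ _ := inv_anti₀ h2k hs
  have hpos : 0 < ‖s⁻¹ • p‖ := by
    rw [norm_pos_iff]
    intro h0
    rw [h0] at hsum
    simp at hsum
  have hent : k ≤ minEntropy (s⁻¹ • p) := by
    rw [minEntropy, le_neg, Real.logb_le_iff_le_rpow one_lt_two hpos]
    exact hnorm
  have hle := h _ hmem hent
  have heq : ∀ y, ((Fintype.card S : ℝ)⁻¹ • ∑ s', (funMatrix ℝ (f s')).mulVec (s⁻¹ • p)) y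
      - uniform ℝ Y y = s⁻¹ * ∑ x, extMatrix ℝ f y x * p x := by
    intro y
    have h1 : uniform ℝ Y y = ((∑ x, (s⁻¹ • p) x) • uniform ℝ Y) y := by rw [hsum, one_smul]
    have h2 : s⁻¹ * ∑ x, extMatrix ℝ f y x * p x = extMap ℝ f (s⁻¹ • p) y := by
      rw [map_smul, Pi.smul_apply, extMap_apply, smul_eq_mul]
    rw [h1, h2]
    generalize s⁻¹ • p = P
    simp [extMap, Finset.sum_mul]
  simp only [heq, abs_mul, abs_of_pos (inv_pos.2 hs0), ← Finset.mul_sum] at hle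
  rwa [inv_mul_le_iff₀ hs0] at hle

lemma sum_abs_extMatrix_sub_le (f : S → X → Y) (p r : X → ℝ) :
    ∑ y, |∑ x, extMatrix ℝ f y x * (p x - r x)| ≤
      ∑ y, |∑ x, extMatrix ℝ f y x * p x| + ∑ y, |∑ x, extMatrix ℝ f y x * r x| := by
  rw [← Finset.sum_add_distrib]
  refine Finset.sum_le_sum fun y _ => ?_
  simp only [mul_sub, Finset.sum_sub_distrib]
  exact abs_sub _ _

variable [Nonempty X]

lemma nonneg_of_isExtractor {f : S → X → Y} {k ε : ℝ} (h : IsExtractor f k ε)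
    (hk : (2 : ℝ) ^ k ≤ Fintype.card X) : 0 ≤ ε := by
  have h1 := sum_abs_extMatrix_le_mul_of_isExtractor h (p := fun _ => 1) (fun _ => zero_le_one)
    (fun _ => le_rfl) (by simpa using hk)
  have h2 : 0 ≤ (∑ _x : X, (1 : ℝ)) * ε := (Finset.sum_nonneg fun _ _ => abs_nonneg _).trans h1
  refine nonneg_of_mul_nonneg_right h2 ?_
  simp [Fintype.card_pos]

/-- An extractor for sources of min-entropy at most `log |X| - 1` is bounded from `ℓ_∞` to `ℓ₁`:
one of the vectors `p` and `1 - p` has mass at least `|X| / 2`. -/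
lemma sum_abs_extMatrix_le_of_isExtractor {f : S → X → Y} {k ε : ℝ} (h : IsExtractor f k ε)
    (hk : 2 * (2 : ℝ) ^ k ≤ Fintype.card X) (b : X → ℝ) (hb : ∀ x, |b x| ≤ 1) :
    ∑ y, |∑ x, extMatrix ℝ f y x * b x| ≤ 4 * (Fintype.card X * ε) := by
  set N : ℝ := (Fintype.card X : ℝ) with hN
  have h2k : (0 : ℝ) < 2 ^ k := Real.rpow_pos_of_pos two_pos k
  have hε : 0 ≤ ε := nonneg_of_isExtractor h (by linarith)
  have hbig : ∀ p : X → ℝ, (∀ x, 0 ≤ p x) → (∀ x, p x ≤ 1) → (2 : ℝ) ^ k ≤ ∑ x, p x →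
      ∑ y, |∑ x, extMatrix ℝ f y x * p x| ≤ N * ε := by
    intro p hp0 hp1 hs
    refine (sum_abs_extMatrix_le_mul_of_isExtractor h hp0 hp1 hs).trans
      (mul_le_mul_of_nonneg_right ?_ hε)
    calc ∑ x, p x ≤ ∑ _x : X, (1 : ℝ) := Finset.sum_le_sum fun x _ => hp1 x
      _ = N := by simp [hN]
  have hpos : ∀ p : X → ℝ, (∀ x, 0 ≤ p x) → (∀ x, p x ≤ 1) →
      ∑ y, |∑ x, extMatrix ℝ f y x * p x| ≤ 2 * (N * ε) := by
    intro p hp0 hp1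
    have hNε : 0 ≤ N * ε := by positivity
    rcases le_total ((2 : ℝ) ^ k) (∑ x, p x) with hs | hs
    · linarith [hbig p hp0 hp1 hs]
    -- A light `p` is written as `1 - (1 - p)`, a difference of two heavy vectors: `1 - p` has mass
    -- at least `|X| - 2^k ≥ 2^k`.
    · have h1 := hbig (fun _ => 1) (fun _ => zero_le_one) (fun _ => le_rfl) (by simp; linarith)
      have h2 := hbig (fun x => 1 - p x) (fun x => sub_nonneg.2 (hp1 x))
        (fun x => sub_le_self _ (hp0 x)) (by simp [Finset.sum_sub_distrib]; linarith)
      have h3 := sum_abs_extMatrix_sub_le f (fun _ => 1) fun x => 1 - p x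
      simp only [sub_sub_cancel] at h3
      linarith
  -- Positive and negative parts of `b` double the bound again, whence the 4.
  have h1 := hpos (fun x => max (b x) 0) (fun x => le_max_right _ _)
    fun x => max_le (abs_le.1 (hb x)).2 zero_le_one
  have h2 := hpos (fun x => max (-b x) 0) (fun x => le_max_right _ _)
    fun x => max_le (by linarith [(abs_le.1 (hb x)).1]) zero_le_one
  have h3 := sum_abs_extMatrix_sub_le f (fun x => max (b x) 0) fun x => max (-b x) 0
  have h4 : ∀ x, max (b x) 0 - max (-b x) 0 = b x := fun x => max_zero_sub_max_neg_zero_eq_self _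
  simp only [h4] at h3
  linarith

end Extractor

/-! ### Quantum side information -/

section SideInformation

variable {X q : Type*} [Fintype X] [DecidableEq X] [Fintype q] [DecidableEq q]

lemma posSemidef_blockDiagonal {ρ : X → Matrix q q ℂ} (hρ : ∀ x, (ρ x).PosSemidef) :
    (Matrix.blockDiagonal ρ).PosSemidef := by
  have h : Matrix.blockDiagonal ρ = (Matrix.blockDiagonal fun x => CFC.sqrt (ρ x)).conjTranspose *
      Matrix.blockDiagonal fun x => CFC.sqrt (ρ x) := by
    rw [Matrix.blockDiagonal_conjTranspose, ← Matrix.blockDiagonal_mul]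
    congr 1
    ext1 x
    rw [← Matrix.star_eq_conjTranspose, (IsSelfAdjoint.of_nonneg (CFC.sqrt_nonneg (ρ x))).star_eq,
      CFC.sqrt_mul_sqrt_self _ (Matrix.nonneg_iff_posSemidef.2 (hρ x))]
  rw [h]
  exact Matrix.posSemidef_conjTranspose_mul_self _

/-- The admissible values of `t` in the definition of the conditional min-entropy. -/
def minEntropyBounds (ρ : Matrix (q × X) (q × X) ℂ) : Set ℝ :=
  {t : ℝ | ∃ σ : Matrix q q ℂ, σ.PosSemidef ∧ σ.trace = 1 ∧
    (((t : ℂ) • (σ ⊗ₖ (1 : Matrix X X ℂ))) - ρ).PosSemidef}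

/-- The trace of `t σ ⊗ 1 - ρ` is `t |X| - 1`. This keeps the infimum in `condMinEntropy` positive,
so that its logarithm is meaningful. -/
lemma inv_card_le_of_mem_minEntropyBounds [Nonempty X] {ρ : Matrix (q × X) (q × X) ℂ}
    (hρ : ρ.trace = 1) {t : ℝ} (ht : t ∈ minEntropyBounds ρ) : (Fintype.card X : ℝ)⁻¹ ≤ t := by
  obtain ⟨σ, -, hσ, h⟩ := ht
  have h0 := h.trace_nonneg
  rw [Matrix.trace_sub, Matrix.trace_smul, Matrix.trace_kronecker, hσ, hρ, Matrix.trace_one,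
    smul_eq_mul, one_mul] at h0
  have h1 : (0 : ℝ) ≤ t * Fintype.card X - 1 := by exact_mod_cast h0
  rw [← one_div, div_le_iff₀ (by exact_mod_cast Fintype.card_pos)]
  linarith

/-- The maximally mixed state is admissible, with `t` large enough to dominate `‖ρ‖`. -/
lemma minEntropyBounds_nonempty [Nonempty q] {ρ : Matrix (q × X) (q × X) ℂ} (hρ : ρ.PosSemidef) :
    (minEntropyBounds ρ).Nonempty := by
  have hq : (Fintype.card q : ℂ) ≠ 0 := by exact_mod_cast Fintype.card_ne_zero
  refine ⟨Fintype.card q * ‖ρ‖, (Fintype.card q : ℂ)⁻¹ • 1, ?_, ?_, ?_⟩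
  · exact Matrix.PosSemidef.one.smul (by positivity)
  · simp [hq]
  · have h := IsSelfAdjoint.le_algebraMap_norm_self (a := ρ) hρ.isHermitian
    rw [Matrix.le_iff] at h
    have e : ((Fintype.card q * ‖ρ‖ : ℝ) : ℂ) • (((Fintype.card q : ℂ)⁻¹ • (1 : Matrix q q ℂ)) ⊗ₖ
        (1 : Matrix X X ℂ)) = algebraMap ℝ (Matrix (q × X) (q × X) ℂ) ‖ρ‖ := by
      rw [Matrix.smul_kronecker, Matrix.one_kronecker_one, smul_smul,
        Algebra.algebraMap_eq_smul_one]
      push_cast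
      rw [mul_right_comm, mul_inv_cancel₀ hq, one_mul]
      ext i j
      simp [Matrix.smul_apply]
    rw [e]
    exact h

/-- The conditioning state may be taken invertible, at the price of a larger `t`. -/
lemma exists_posDef_of_mem_minEntropyBounds [Nonempty q] {ρ : X → Matrix q q ℂ} {t₁ t : ℝ}
    (ht₁ : t₁ ∈ minEntropyBounds (Matrix.blockDiagonal ρ)) (h₁ : 0 < t₁) (h : t₁ < t) :
    ∃ σ : Matrix q q ℂ, σ.PosDef ∧ σ.trace = 1 ∧ ∀ x, ((t : ℂ) • σ - ρ x).PosSemidef := by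
  obtain ⟨σ, hσ, htr, hle⟩ := ht₁
  have hq : (Fintype.card q : ℂ) ≠ 0 := by exact_mod_cast Fintype.card_ne_zero
  have ht : 0 < t := h₁.trans h
  have htC : (t : ℂ) ≠ 0 := by exact_mod_cast ht.ne'
  have hblock : ∀ x, ((t₁ : ℂ) • σ - ρ x).PosSemidef := by
    intro x
    have := hle.submatrix fun i : q => (i, x)
    convert this using 1
    ext i j
    simp [Matrix.blockDiagonal_apply]
  have hsub : (0 : ℂ) < ((t - t₁ : ℝ) : ℂ) := by exact_mod_cast sub_pos.2 h
  have hcard : (0 : ℂ) < (Fintype.card q : ℂ) := by exact_mod_cast Fintype.card_pos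
  have hone : ((((t - t₁ : ℝ) : ℂ) * (Fintype.card q : ℂ)⁻¹) • (1 : Matrix q q ℂ)).PosDef :=
    Matrix.PosDef.one.smul (mul_pos hsub (inv_pos.2 hcard))
  have ht1C : (0 : ℂ) ≤ (t₁ : ℂ) := by exact_mod_cast h₁.le
  have htC' : (0 : ℂ) < (t : ℂ) := by exact_mod_cast ht
  -- The mixture of `σ` and the maximally mixed state with weights `t₁ / t` and `1 - t₁ / t`.
  refine ⟨(t : ℂ)⁻¹ • ((t₁ : ℂ) • σ +
    (((t - t₁ : ℝ) : ℂ) * (Fintype.card q : ℂ)⁻¹) • (1 : Matrix q q ℂ)), ?_, ?_, fun x => ?_⟩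
  · exact (Matrix.PosDef.posSemidef_add (hσ.smul ht1C) hone).smul (inv_pos.2 htC')
  · simp only [Matrix.trace_smul, Matrix.trace_add, htr, Matrix.trace_one, smul_eq_mul]
    push_cast
    field_simp
    ring
  · rw [smul_smul, mul_inv_cancel₀ htC, one_smul, add_sub_right_comm]
    exact (hblock x).add hone.posSemidef

/-- If `0 ≤ ρ ≤ t σ` with `σ` invertible, then `ρ = √σ C √σ` with `‖C‖ ≤ t`. -/
lemma exists_sqrt_mul_mul_sqrt {σ : Matrix q q ℂ} (hσ : σ.PosDef) {t : ℝ} (ht : 0 ≤ t)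
    {ρ : Matrix q q ℂ} (hρ : ρ.PosSemidef) (h : ((t : ℂ) • σ - ρ).PosSemidef) :
    ∃ C : Matrix q q ℂ, ‖C‖ ≤ t ∧ ρ = CFC.sqrt σ * C * CFC.sqrt σ := by
  have hσ0 : 0 ≤ σ := Matrix.nonneg_iff_posSemidef.2 hσ.posSemidef
  set s := CFC.sqrt σ with hs
  have hss : s * s = σ := CFC.sqrt_mul_sqrt_self σ hσ0
  have hsu : IsUnit s.det := by
    rw [← Matrix.isUnit_iff_isUnit_det]
    exact (CFC.isUnit_sqrt_iff σ hσ0).2 hσ.isUnit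
  have hsh : s.conjTranspose = s := (IsSelfAdjoint.of_nonneg (CFC.sqrt_nonneg σ)).star_eq
  have hih : s⁻¹.conjTranspose = s⁻¹ := by rw [Matrix.conjTranspose_nonsing_inv, hsh]
  have h1 : s * s⁻¹ = 1 := Matrix.mul_nonsing_inv s hsu
  have h2 : s⁻¹ * s = 1 := Matrix.nonsing_inv_mul s hsu
  refine ⟨s⁻¹ * ρ * s⁻¹, ?_, ?_⟩
  · have hp := hρ.conjTranspose_mul_mul_same s⁻¹
    have hq := h.conjTranspose_mul_mul_same s⁻¹
    rw [hih] at hp hq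
    rw [CStarAlgebra.norm_le_iff_le_algebraMap _ ht (Matrix.nonneg_iff_posSemidef.2 hp),
      Matrix.le_iff]
    have : s⁻¹ * σ * s⁻¹ = 1 := by
      rw [← hss, ← mul_assoc, h2, one_mul, h1]
    rw [mul_sub, sub_mul, Matrix.mul_smul, Matrix.smul_mul, this] at hq
    rw [Algebra.algebraMap_eq_smul_one]
    exact hq
  · calc ρ = (s * s⁻¹) * ρ * (s⁻¹ * s) := by rw [h1, h2, one_mul, mul_one]
      _ = s * (s⁻¹ * ρ * s⁻¹) * s := by simp only [mul_assoc]

lemma hsSq_sqrt {σ : Matrix q q ℂ} (hσ : σ.PosSemidef) : hsSq (CFC.sqrt σ) = σ.trace.re := by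
  have hσ0 : 0 ≤ σ := Matrix.nonneg_iff_posSemidef.2 hσ
  have hsh : (CFC.sqrt σ).conjTranspose = CFC.sqrt σ :=
    (IsSelfAdjoint.of_nonneg (CFC.sqrt_nonneg σ)).star_eq
  rw [← trace_conjTranspose_mul_self_re, hsh, CFC.sqrt_mul_sqrt_self σ hσ0]

end SideInformation

/-! ### Extractors against quantum side information -/

section QuantumProof

variable {X Y S : Type*} [Fintype X] [DecidableEq X] [Nonempty X] [Fintype Y] [Fintype S]
  [DecidableEq Y]

/-- The conditional min-entropy is at most `log |X|`, and a bound on it yields an invertible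
conditioning state. -/
lemma exists_posDef_of_le_condMinEntropy {Q : ℕ} {ρ : X → Matrix (Fin Q) (Fin Q) ℂ}
    (hρ : ∀ x, (ρ x).PosSemidef) (htr : ∑ x, (ρ x).trace = 1) {k : ℝ}
    (hk : k ≤ condMinEntropy (Matrix.blockDiagonal ρ)) :
    (2 : ℝ) ^ k ≤ Fintype.card X ∧ ∀ t : ℝ, (2 : ℝ) ^ (-k) < t →
      ∃ σ : Matrix (Fin Q) (Fin Q) ℂ, σ.PosDef ∧ σ.trace = 1 ∧
        ∀ x, ((t : ℂ) • σ - ρ x).PosSemidef := by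
  have hQ : Nonempty (Fin Q) := by
    by_contra hQ
    rw [not_nonempty_iff] at hQ
    simp [Matrix.trace] at htr
  have hN : (0 : ℝ) < Fintype.card X := by exact_mod_cast Fintype.card_pos
  have htr' : (Matrix.blockDiagonal ρ).trace = 1 := by rw [Matrix.trace_blockDiagonal, htr]
  have hne : (minEntropyBounds (Matrix.blockDiagonal ρ)).Nonempty :=
    minEntropyBounds_nonempty (posSemidef_blockDiagonal hρ)
  have hlow : (Fintype.card X : ℝ)⁻¹ ≤ sInf (minEntropyBounds (Matrix.blockDiagonal ρ)) :=
    le_csInf hne fun t ht => inv_card_le_of_mem_minEntropyBounds htr' ht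
  have hpos : 0 < sInf (minEntropyBounds (Matrix.blockDiagonal ρ)) := (inv_pos.2 hN).trans_le hlow
  have hup : sInf (minEntropyBounds (Matrix.blockDiagonal ρ)) ≤ (2 : ℝ) ^ (-k) := by
    rw [← Real.logb_le_iff_le_rpow one_lt_two hpos]
    exact le_neg.1 hk
  refine ⟨?_, fun t ht => ?_⟩
  · have := hlow.trans hup
    rwa [Real.rpow_neg two_pos.le, inv_le_inv₀ hN (Real.rpow_pos_of_pos two_pos _)] at this
  · obtain ⟨t₁, ht₁, hlt⟩ := exists_lt_of_csInf_lt hne (hup.trans_lt ht)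
    exact exists_posDef_of_mem_minEntropyBounds ht₁
      ((inv_pos.2 hN).trans_le (inv_card_le_of_mem_minEntropyBounds htr' ht₁)) hlt

lemma quantum_output_eq_blockDiagonal (f : S → X → Y) {Q : ℕ} (ρ : X → Matrix (Fin Q) (Fin Q) ℂ) :
    (Fintype.card S : ℂ)⁻¹ •
        ∑ s, Matrix.blockDiagonal (fun y => ∑ x, funMatrix ℂ (f s) y x • ρ x)
      - (∑ x, ρ x) ⊗ₖ Matrix.diagonal (uniform ℂ Y) =
    Matrix.blockDiagonal fun y => ∑ x, ((extMatrix ℝ f y x : ℝ) : ℂ) • ρ x := by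
  ext ⟨i, y⟩ ⟨j, y'⟩
  simp only [Matrix.sub_apply, Matrix.smul_apply, Matrix.sum_apply, Matrix.blockDiagonal_apply,
    Matrix.kroneckerMap_apply, Matrix.diagonal_apply, uniform, ofReal_extMatrix,
    smul_eq_mul]
  split_ifs with hy
  · simp only [extMatrix, sub_mul, Finset.sum_sub_distrib, Finset.sum_mul, Finset.mul_sum]
    rw [Finset.sum_comm]
    simp only [mul_assoc, mul_comm (ρ _ i j)]
  · simp

/-- An extractor is quantum-proof, at min-entropy larger by one. -/
theorem traceNorm_quantum_output_le {f : S → X → Y} {k ε : ℝ} (h : IsExtractor f k ε) {Q : ℕ}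
    {ρ : X → Matrix (Fin Q) (Fin Q) ℂ} (hρ : ∀ x, (ρ x).PosSemidef) (htr : ∑ x, (ρ x).trace = 1)
    (hk : k + 1 ≤ condMinEntropy (Matrix.blockDiagonal ρ)) :
    0 ≤ ε ∧ traceNorm ((Fintype.card S : ℂ)⁻¹ •
        ∑ s, Matrix.blockDiagonal (fun y => ∑ x, funMatrix ℂ (f s) y x • ρ x)
      - (∑ x, ρ x) ⊗ₖ Matrix.diagonal (uniform ℂ Y)) ≤
        grothendieckConstant * ((2 : ℝ) ^ (-k) * (4 * (Fintype.card X * ε))) := by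
  obtain ⟨hcard, hσ⟩ := exists_posDef_of_le_condMinEntropy hρ htr hk
  have h2k : (0 : ℝ) < 2 ^ k := Real.rpow_pos_of_pos two_pos k
  -- The extra bit of min-entropy is used twice: here, to make room for the splitting into heavy
  -- vectors, and below for the strict inequality `2^(-(k+1)) < 2^(-k)` that allows an invertible
  -- `σ`.
  have hcard' : 2 * (2 : ℝ) ^ k ≤ Fintype.card X := by
    rwa [Real.rpow_add two_pos, Real.rpow_one, mul_comm] at hcard
  refine ⟨nonneg_of_isExtractor h (by linarith), ?_⟩
  obtain ⟨σ, hσ, hσtr, hle⟩ := hσ ((2 : ℝ) ^ (-k))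
    (Real.rpow_lt_rpow_of_exponent_lt one_lt_two (by linarith))
  have ht : (0 : ℝ) < 2 ^ (-k) := Real.rpow_pos_of_pos two_pos _
  choose C hC hCρ using fun x => exists_sqrt_mul_mul_sqrt hσ ht.le (hρ x) (hle x)
  have hhs : hsSq (CFC.sqrt σ) ≤ 1 := by rw [hsSq_sqrt hσ.posSemidef, hσtr, Complex.one_re]
  refine le_of_eq_of_le ?_ (traceNorm_blockDiagonal_le
    (sum_bilin_le_of_sum_abs_le (sum_abs_extMatrix_le_of_isExtractor h hcard')) hhs hhs ht hC)
  rw [quantum_output_eq_blockDiagonal]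
  congr 2
  ext1 y
  rw [Finset.mul_sum, Finset.sum_mul]
  refine Finset.sum_congr rfl fun x _ => ?_
  rw [Matrix.mul_smul, Matrix.smul_mul, ← hCρ x]

end QuantumProof

end QExt

end

theorem theorem4 {S Y : Type*} [Fintype S] [Nonempty S] [Fintype Y] [Nonempty Y] [DecidableEq Y]
    (n : ℕ) (f : S → (Fin n → Bool) → Y) (k ε : ℝ) :
    -- the bound on the completely bounded norm, from real or from complex input vectors
    (k ≤ n →
      (QExt.boundedNorm (QExt.capNorm ((2 : ℝ) ^ k)) QExt.l1Norm (QExt.extMap ℝ f)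
          ≤ ENNReal.ofReal ε ∨
        QExt.boundedNorm (QExt.capNorm ((2 : ℝ) ^ k)) QExt.l1Norm (QExt.extMap ℂ f)
          ≤ ENNReal.ofReal ε) →
      QExt.cbNorm (QExt.capCapNorm ((2 : ℝ) ^ k)) QExt.l1MatrixNorm (QExt.extMap ℂ f)
        ≤ ENNReal.ofReal (QExt.grothendieckConstant * (2 : ℝ) ^ ((n : ℝ) - k) * ε)) ∧
    -- every extractor is quantum-proof with modified parameters
    (QExt.IsExtractor f k ε →
      QExt.IsQuantumProofExtractor f (k + 1)
        (6 * QExt.grothendieckConstant * (2 : ℝ) ^ ((n : ℝ) - k) * ε)) ∧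
    -- the case of very high min-entropy
    (1 ≤ n → (n : ℝ) - Real.logb 2 n ≤ k → QExt.IsExtractor f k ε →
      QExt.IsQuantumProofExtractor f (k + 1) (6 * QExt.grothendieckConstant * n * ε)) := by
  have hcard : ((Fintype.card (Fin n → Bool) : ℕ) : ℝ) = (2 : ℝ) ^ (n : ℝ) := by simp
  have hKG := QExt.grothendieckConstant_nonneg
  have hdiv : (2 : ℝ) ^ ((n : ℝ) - k) = (2 : ℝ) ^ (-k) * 2 ^ (n : ℝ) := by
    rw [← Real.rpow_add two_pos, neg_add_eq_sub]
  have hquantum : QExt.IsExtractor f k ε → QExt.IsQuantumProofExtractor f (k + 1)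
      (6 * QExt.grothendieckConstant * (2 : ℝ) ^ ((n : ℝ) - k) * ε) := by
    intro h Q ρ hρ htr hk
    obtain ⟨hε, hle⟩ := QExt.traceNorm_quantum_output_le h hρ htr hk
    refine hle.trans ?_
    rw [hcard]
    have : 0 ≤ QExt.grothendieckConstant * (2 : ℝ) ^ ((n : ℝ) - k) * ε := by positivity
    rw [hdiv] at this ⊢
    -- The argument gives the constant 4, which is weakened to 6.
    linarith
  refine ⟨fun hkn hb => ?_, hquantum, fun hn hk h Q ρ hρ htr hent => ?_⟩
  · have hreal : QExt.boundedNorm (QExt.capNorm ((2 : ℝ) ^ k)) QExt.l1Norm (QExt.extMap ℝ f)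
        ≤ ENNReal.ofReal ε := hb.elim id (QExt.boundedNorm_real_le_complex f _).trans
    have h2k : (0 : ℝ) < 2 ^ k := Real.rpow_pos_of_pos two_pos k
    refine (QExt.cbNorm_extMap_le f h2k (QExt.sum_abs_extMatrix_le_of_boundedNorm_le
      (by rw [hcard]; exact Real.rpow_le_rpow_of_exponent_le one_le_two hkn) hreal)).trans_eq ?_
    -- Once the nonnegative factors are split off, `max ε 0` and `ε` agree under `ENNReal.ofReal`.
    rw [hcard, ← Real.rpow_neg two_pos.le, ← mul_assoc ((2 : ℝ) ^ (-k)), ← hdiv, ← mul_assoc,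
      ENNReal.ofReal_mul (q := max ε 0) (by positivity),
      ENNReal.ofReal_mul (q := ε) (by positivity)]
    simp
  · refine (hquantum h Q ρ hρ htr hent).trans ?_
    -- Monotonicity in the constant needs `0 ≤ ε`, which holds because a state of min-entropy `k +
    -- 1` exists.
    have hε := (QExt.traceNorm_quantum_output_le h hρ htr hent).1
    have hn0 : (0 : ℝ) < n := by exact_mod_cast hn
    have hpow : (2 : ℝ) ^ ((n : ℝ) - k) ≤ n := by
      rw [← Real.le_logb_iff_rpow_le one_lt_two hn0]
      linarith
    gcongr
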